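/- Let $X$ be a proper $\mathrm{CAT}(0)$ space, let $G \le \mathrm{Is}(X)$ be any subgroup of its isometry group, and let $\rho\colon \mathbf{R} \to X$ be a geodesic map, i.e. an isometric embedding. Let $(t_n)_{n\ge 0}$ be a strictly increasing sequence of positive real numbers tending to infinity such that $\sup_n d(\rho(t_n),\rho(t_{n+1})) < \infty$ and such that the set $\{\rho(t_n)\}_{n\ge 0}$ falls into finitely many $G$-orbits, each of which is discrete. An isometry $\gamma$ of $X$ is hyperbolic if $|\gamma| = \inf_{x\in X} d(x,\gamma x)$ is positive and attained; a translation axis of $\gamma$ is a geodesic line on which $\gamma$ acts as a nontrivial translation. A geodesic line has rank one if it does not bound a flat half-plane (an isometrically embedded closed Euclidean half-plane with that line as its boundary); an isometry is rank-one if it is hyperbolic and some axis of it has rank one. Then: 1. There is a strictly increasing sequence $(f(n))_{n\ge 0}$ of positive integers such that for all $n > m > 0$ there is a hyperbolic isometry $h_{m,n} \in G$ which has a translation axis containing the geodesic segment $[\rho(t_{f(m)}), \rho(t_{f(n)})]$. 2. Suppose in addition that the geodesic line $\rho(\mathbf{R})$ is a translation axis of a rank-one element of $\mathrm{Is}(X)$.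 Then for every strictly increasing sequence $(f(n))_{n\ge 0}$ of positive integers and every $m > 0$ there is $N_m > 0$ such that, for every $n > N_m$ with $n>m$, every hyperbolic isometry $h_{m,n} \in G$ which has a translation axis containing $[\rho(t_{f(m)}), \rho(t_{f(n)})]$ is rank-one. In particular, this holds for any sequence $f$ and isometries $h_{m,n}$ as in part 1. -/

import Mathlib

/-- A `CAT(0)` space: a geodesic metric space all of whose geodesic triangles are at least as thin
as their comparison triangles in the Euclidean plane.  In a geodesic space, the points lying on
some geodesic segment from `p` to `q` are exactly those `x` with
`dist p x + dist x q = dist p q`.  As `p`, `q`, `r` are arbitrary, `x` and `y` range over points on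
any two sides of any geodesic triangle. -/
class IsCAT0Space (X : Type*) [MetricSpace X] : Prop where
  /-- Any two points are joined by a geodesic segment. -/
  exists_geodesic : ∀ x y : X, ∃ c : ℝ → X, c 0 = x ∧ c (dist x y) = y ∧
    ∀ s ∈ Set.Icc 0 (dist x y), ∀ t ∈ Set.Icc 0 (dist x y), dist (c s) (c t) = |s - t|
  /-- The comparison inequality: `p' q' r'` is a comparison triangle for `p q r`, the point `x'` of
  `[p', q']` is the comparison point of `x ∈ [p, q]`, and the point `y'` of `[p', r']` is the
  comparison point of `y ∈ [p, r]`. -/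
  comparison : ∀ (p q r x y : X) (p' q' r' x' y' : EuclideanSpace ℝ (Fin 2)),
    dist p' q' = dist p q → dist p' r' = dist p r → dist q' r' = dist q r →
    dist p x + dist x q = dist p q → dist p y + dist y r = dist p r →
    dist p' x' = dist p x → dist x' q' = dist x q →
    dist p' y' = dist p y → dist y' r' = dist y r →
    dist x y ≤ dist x' y'

/-- The closed upper half-plane of the Euclidean plane. -/
def euclideanHalfPlane : Set (EuclideanSpace ℝ (Fin 2)) := {p | 0 ≤ p 1}

/-- The boundary line of the closed upper half-plane. -/
def euclideanHalfPlaneBoundary : Set (EuclideanSpace ℝ (Fin 2)) := {p | p 1 = 0}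

section

variable {X : Type*} [MetricSpace X]

/-- `L` is a geodesic line: the image of an isometric embedding of `ℝ`. -/
def IsGeodesicLine (L : Set X) : Prop :=
  ∃ c : ℝ → X, Isometry c ∧ Set.range c = L

/-- `L` bounds a flat half-plane: some isometrically embedded Euclidean half-plane has `L` as its
boundary line. -/
def BoundsFlatHalfPlane (L : Set X) : Prop :=
  ∃ φ : EuclideanSpace ℝ (Fin 2) → X,
    (∀ p ∈ euclideanHalfPlane, ∀ q ∈ euclideanHalfPlane, dist (φ p) (φ q) = dist p q) ∧
    φ '' euclideanHalfPlaneBoundary = L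

/-- A geodesic line has rank one if it does not bound a flat half-plane. -/
def IsRankOneLine (L : Set X) : Prop :=
  IsGeodesicLine L ∧ ¬ BoundsFlatHalfPlane L

/-- The translation length `|γ| = inf_x d(x, γ x)`. -/
noncomputable def translationLength (γ : X ≃ᵢ X) : ℝ := ⨅ x : X, dist x (γ x)

/-- `γ` is hyperbolic: its translation length is positive and attained. -/
def IsHyperbolicIsometry (γ : X ≃ᵢ X) : Prop :=
  0 < translationLength γ ∧ ∃ x : X, dist x (γ x) = translationLength γ

/-- `L` is a (translation) axis of `γ`: a geodesic line on which `γ` acts as a nontrivial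
translation. -/
def IsTranslationAxis (γ : X ≃ᵢ X) (L : Set X) : Prop :=
  ∃ c : ℝ → X, Isometry c ∧ Set.range c = L ∧ ∃ a : ℝ, 0 < a ∧ ∀ s : ℝ, γ (c s) = c (s + a)

/-- `γ` is a rank-one isometry: it is hyperbolic and some axis of it has rank one. -/
def IsRankOneIsometry (γ : X ≃ᵢ X) : Prop :=
  IsHyperbolicIsometry γ ∧ ∃ L : Set X, IsTranslationAxis γ L ∧ IsRankOneLine L

/-- The orbit of a point under a group of isometries. -/
def isometryOrbit (G : Subgroup (X ≃ᵢ X)) (x : X) : Set X := {y | ∃ g ∈ G, g x = y}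

/-- `h` closes up `ρ` on `[a, b]`: it is a hyperbolic isometry one of whose translation axes
contains the geodesic segment `[ρ(a), ρ(b)]` (here `a ≤ b`). -/
def IsClosingIsometry (ρ : ℝ → X) (a b : ℝ) (h : X ≃ᵢ X) : Prop :=
  IsHyperbolicIsometry h ∧ ∃ L : Set X, IsTranslationAxis h L ∧ ρ '' Set.Icc a b ⊆ L

end

open Filter Topology

/-! Part 1. There are finitely many orbits, bounded gaps, and finitely many points of a discrete
orbit in each ball. By pigeonhole, along a subsequence any pair of consecutive points of the
sequence is carried to any other by an element of `G` (`exists_strictMono_carrying`). Such an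
element pushes an initial piece of a segment of `ρ` forward along `ρ`, so the translates of the
segment join up to a local geodesic. In a `CAT(0)` space this is a geodesic, hence an axis
(`exists_axis_of_translates_initial`).

Part 2. Otherwise arbitrarily long segments of `ρ` lie on axes bounding flat half-planes. Powers of
the given translation `g` along `ρ` recentre these half-planes, and properness gives a limit
half-plane bounded by `ρ(ℝ)` (`boundsFlatHalfPlane_of_segments`). Rank one is only known for some
axis of `g`, so the half-plane is transferred to that axis
(`BoundsFlatHalfPlane.of_isTranslationAxis`). The transfer uses the flat strip theorem
(`exists_dist_sq_parallel`, `exists_flatStrip`): lines high up in the half-plane are parallel to the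
other axis and span wide strips with it. -/

theorem dist_sq_euclideanPlane (p q : EuclideanSpace ℝ (Fin 2)) :
    dist p q ^ 2 = (p 0 - q 0) ^ 2 + (p 1 - q 1) ^ 2 := by
  rw [EuclideanSpace.dist_eq, Real.sq_sqrt (by positivity), Fin.sum_univ_two, Real.dist_eq,
    Real.dist_eq, sq_abs, sq_abs]

theorem exists_comparison_triangle {a b c : ℝ} (ha : 0 ≤ a) (hb : 0 ≤ b)
    (hab : c ≤ a + b) (hac : b ≤ a + c) (hbc : a ≤ b + c) :
    ∃ p q r : EuclideanSpace ℝ (Fin 2), dist p q = a ∧ dist p r = b ∧ dist q r = c := by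
  have hc : 0 ≤ c := by linarith
  have key (p q : EuclideanSpace ℝ (Fin 2)) {d : ℝ} (hd : 0 ≤ d)
      (h : (p 0 - q 0) ^ 2 + (p 1 - q 1) ^ 2 = d ^ 2) : dist p q = d := by
    rw [← dist_sq_euclideanPlane] at h
    exact (sq_eq_sq₀ dist_nonneg hd).1 h
  rcases ha.eq_or_lt with h | h
  · subst h
    have : b = c := by linarith
    subst this
    refine ⟨!₂[0, 0], !₂[0, 0], !₂[b, 0], key _ _ le_rfl ?_, key _ _ hb ?_, key _ _ hb ?_⟩ <;> simp
  -- By the law of cosines, `u` is the first coordinate of the third vertex.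
  · obtain ⟨u, hu⟩ : ∃ u, 2 * a * u = a ^ 2 + b ^ 2 - c ^ 2 :=
      ⟨(a ^ 2 + b ^ 2 - c ^ 2) / (2 * a), by field_simp⟩
    have h1 : u ≤ b := by
      have : 2 * a * u ≤ 2 * a * b := by nlinarith
      exact le_of_mul_le_mul_left this (by positivity)
    have h2 : -b ≤ u := by
      have : 2 * a * (-b) ≤ 2 * a * u := by nlinarith
      exact le_of_mul_le_mul_left this (by positivity)
    have hv : Real.sqrt (b ^ 2 - u ^ 2) ^ 2 = b ^ 2 - u ^ 2 := Real.sq_sqrt (by nlinarith)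
    refine ⟨!₂[0, 0], !₂[a, 0], !₂[u, Real.sqrt (b ^ 2 - u ^ 2)], key _ _ ha ?_, key _ _ hb ?_,
      key _ _ hc ?_⟩
    · simp
    · simp [hv]
    · simp only [Matrix.cons_val_zero, Matrix.cons_val_one]
      linear_combination hv - hu

/-! ### Comparison inequalities and local geodesics -/

section CAT0

variable {X : Type*} [MetricSpace X] [IsCAT0Space X]

/-- The comparison inequality of a `CAT(0)` space, with the Euclidean distance written out. -/
theorem IsCAT0Space.dist_sq_le {p q r x y : X} {u v : ℝ} (hu : u ∈ Set.Icc (0 : ℝ) 1)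
    (hv : v ∈ Set.Icc (0 : ℝ) 1) (hpx : dist p x = u * dist p q)
    (hxq : dist x q = (1 - u) * dist p q) (hpy : dist p y = v * dist p r)
    (hyr : dist y r = (1 - v) * dist p r) :
    dist x y ^ 2 ≤ u ^ 2 * dist p q ^ 2 + v ^ 2 * dist p r ^ 2
      - u * v * (dist p q ^ 2 + dist p r ^ 2 - dist q r ^ 2) := by
  obtain ⟨p', q', r', h1, h2, h3⟩ := exists_comparison_triangle (a := dist p q) (b := dist p r)
    (c := dist q r) dist_nonneg dist_nonneg (dist_comm p q ▸ dist_triangle q p r)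
    (dist_triangle p q r) (dist_comm q r ▸ dist_triangle p r q)
  have h := IsCAT0Space.comparison p q r x y p' q' r' (AffineMap.lineMap p' q' u)
    (AffineMap.lineMap p' r' v) h1 h2 h3 (by rw [hpx, hxq]; ring) (by rw [hpy, hyr]; ring)
    (by rw [dist_left_lineMap, h1, hpx, Real.norm_of_nonneg hu.1])
    (by rw [dist_lineMap_right, h1, hxq, Real.norm_of_nonneg (by linarith [hu.2])])
    (by rw [dist_left_lineMap, h2, hpy, Real.norm_of_nonneg hv.1])
    (by rw [dist_lineMap_right, h2, hyr, Real.norm_of_nonneg (by linarith [hv.2])])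
  have h' := pow_le_pow_left₀ dist_nonneg h 2
  refine h'.trans (le_of_eq ?_)
  rw [← h1, ← h2, ← h3]
  simp only [dist_sq_euclideanPlane, AffineMap.lineMap_apply, vsub_eq_sub, vadd_eq_add,
    PiLp.add_apply, PiLp.smul_apply, PiLp.sub_apply, smul_eq_mul]
  ring

/-- The Bruhat–Tits (CN) inequality, for an arbitrary point of the segment. -/
theorem IsCAT0Space.dist_sq_le_of_between {p q r x : X} {u : ℝ} (hu : u ∈ Set.Icc (0 : ℝ) 1)
    (hpx : dist p x = u * dist p q) (hxq : dist x q = (1 - u) * dist p q) :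
    dist x r ^ 2 ≤ (1 - u) * dist p r ^ 2 + u * dist q r ^ 2 - u * (1 - u) * dist p q ^ 2 := by
  have := IsCAT0Space.dist_sq_le (r := r) (y := r) hu (v := 1) (by simp) hpx hxq (by simp)
    (by simp)
  linarith

theorem IsCAT0Space.exists_between (p q : X) {u : ℝ} (hu : u ∈ Set.Icc (0 : ℝ) 1) :
    ∃ x, dist p x = u * dist p q ∧ dist x q = (1 - u) * dist p q := by
  obtain ⟨c, h0, h1, hc⟩ := IsCAT0Space.exists_geodesic p q
  have hd : 0 ≤ dist p q := dist_nonneg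
  have hm : u * dist p q ∈ Set.Icc 0 (dist p q) :=
    ⟨mul_nonneg hu.1 hd, mul_le_of_le_one_left hd hu.2⟩
  refine ⟨c (u * dist p q), ?_, ?_⟩
  · have := hc 0 ⟨le_rfl, hd⟩ _ hm
    rwa [h0, zero_sub, abs_neg, abs_of_nonneg hm.1] at this
  · have := hc _ hm _ ⟨hd, le_rfl⟩
    rw [h1, abs_sub_comm, abs_of_nonneg (by linarith [hm.2])] at this
    rw [this]; ring

/-- Two geodesic segments that overlap in a nondegenerate segment concatenate to a geodesic. -/
theorem IsCAT0Space.dist_eq_of_overlap {x y z w : X} (hyz : y ≠ z)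
    (h1 : dist x y + dist y z = dist x z) (h2 : dist y z + dist z w = dist y w) :
    dist x w = dist x z + dist z w := by
  have hpos : 0 < dist y z := dist_pos.2 hyz
  have hxy : 0 ≤ dist x y := dist_nonneg
  have hzw : 0 ≤ dist z w := dist_nonneg
  have ha : 0 < dist x z := by linarith
  refine le_antisymm (dist_triangle _ _ _) ?_
  obtain ⟨u, hu⟩ : ∃ u, dist y z = u * dist x z := ⟨dist y z / dist x z, by field_simp⟩
  have hu0 : 0 < u := by
    by_contra! h
    nlinarith
  have hu1 : u ≤ 1 := by
    by_contra! h
    nlinarith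
  -- Comparison in the triangle `z, x, w` with `y` on `[z, x]`: the length of `[y, w]` is known,
  -- which forces the angle at `z` to be straight.
  have h := IsCAT0Space.dist_sq_le_of_between (p := z) (q := x) (r := w) (x := y) (u := u)
    ⟨hu0.le, hu1⟩ (by rw [dist_comm z y, dist_comm z x, hu])
    (by rw [dist_comm y x, dist_comm z x]; linarith)
  rw [← h2, hu, dist_comm z x] at h
  have h' : u * (dist x z + dist z w) ^ 2 ≤ u * dist x w ^ 2 := by nlinarith
  exact le_of_sq_le_sq (le_of_mul_le_mul_left h' hu0) dist_nonneg

/-- The quadrilateral inequality. -/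
theorem IsCAT0Space.quadrilateral (x y z w : X) :
    dist x z ^ 2 + dist y w ^ 2 ≤ dist x y ^ 2 + dist y z ^ 2 + dist z w ^ 2 + dist w x ^ 2 := by
  have hh : (1 / 2 : ℝ) ∈ Set.Icc (0 : ℝ) 1 := by norm_num
  obtain ⟨m, hm1, hm2⟩ := IsCAT0Space.exists_between x z hh
  have h1 := IsCAT0Space.dist_sq_le_of_between (r := y) hh hm1 hm2
  have h2 := IsCAT0Space.dist_sq_le_of_between (r := w) hh hm1 hm2
  have h3 : dist y w ≤ dist m y + dist m w := by
    rw [dist_comm m y]; exact dist_triangle _ _ _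
  have h4 : dist y w ^ 2 ≤ (dist m y + dist m w) ^ 2 := pow_le_pow_left₀ dist_nonneg h3 2
  rw [dist_comm z y] at h1
  rw [dist_comm x w] at h2
  nlinarith [sq_nonneg (dist m y - dist m w)]

/-- Convexity of the metric along two geodesics, at midpoints. -/
theorem IsCAT0Space.dist_midpoint_le {c c' : ℝ → X} (hc : Isometry c) (hc' : Isometry c')
    (s r s' r' : ℝ) : dist (c ((s + r) / 2)) (c' ((s' + r') / 2)) ≤
      (dist (c s) (c' s') + dist (c r) (c' r')) / 2 := by
  have hh : (1 / 2 : ℝ) ∈ Set.Icc (0 : ℝ) 1 := by norm_num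
  have mid {c : ℝ → X} (hc : Isometry c) (s r : ℝ) :
      dist (c s) (c ((s + r) / 2)) = 1 / 2 * dist (c s) (c r) ∧
      dist (c ((s + r) / 2)) (c r) = (1 - 1 / 2) * dist (c s) (c r) := by
    simp only [hc.dist_eq, Real.dist_eq]
    constructor
    · rw [show s - (s + r) / 2 = 1 / 2 * (s - r) by ring, abs_mul]; norm_num
    · rw [show (s + r) / 2 - r = 1 / 2 * (s - r) by ring, abs_mul]; norm_num
  -- The diagonal from `c s` to `c' r'` cuts the quadrilateral into two triangles, and each
  -- contributes a midline through `m`.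
  obtain ⟨m, hm1, hm2⟩ := IsCAT0Space.exists_between (c s) (c' r') hh
  have h1 := IsCAT0Space.dist_sq_le hh hh (mid hc s r).1 (mid hc s r).2 hm1 hm2
  have h2 := IsCAT0Space.dist_sq_le (p := c' r') (q := c s) (r := c' s') (x := m)
    (y := c' ((s' + r') / 2)) hh hh
    (by rw [dist_comm, hm2, dist_comm (c s)]; norm_num)
    (by rw [dist_comm, hm1, dist_comm (c s)]; norm_num)
    (by rw [dist_comm, (mid hc' s' r').2, dist_comm (c' s')]; norm_num)
    (by rw [dist_comm, (mid hc' s' r').1, dist_comm (c' s')]; norm_num)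
  have h1' : dist (c ((s + r) / 2)) m ≤ dist (c r) (c' r') / 2 :=
    le_of_sq_le_sq (by linarith) (by positivity)
  have h2' : dist m (c' ((s' + r') / 2)) ≤ dist (c s) (c' s') / 2 :=
    le_of_sq_le_sq (by linarith) (by positivity)
  linarith [dist_triangle (c ((s + r) / 2)) m (c' ((s' + r') / 2))]

end CAT0

/-- In a `CAT(0)` space, uniformly local geodesics are geodesics. -/
theorem IsCAT0Space.isometry_of_local {X : Type*} [MetricSpace X] [IsCAT0Space X] {c : ℝ → X}
    {δ : ℝ} (hδ : 0 < δ)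
    (hc : ∀ s r, s ≤ r → r ≤ s + δ → dist (c s) (c r) = r - s) : Isometry c := by
  -- Each step gains only `δ / 2`, so that the new piece of length `δ` overlaps the known geodesic
  -- in length `δ / 2`.
  have key (n : ℕ) : ∀ s r, s ≤ r → r ≤ s + δ + n * (δ / 2) → dist (c s) (c r) = r - s := by
    induction n with
    | zero => intro s r h1 h2; exact hc s r h1 (by simpa using h2)
    | succ n ih =>
      intro s r h1 h2
      push_cast at h2
      rcases le_or_gt r (s + δ + n * (δ / 2)) with h | h
      · exact ih s r h1 h
      · have hn : 0 ≤ n * (δ / 2) := by positivity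
        have e1 := ih s (r - δ) (by linarith) (by linarith)
        have e2 := ih s (r - δ / 2) (by linarith) (by linarith)
        have e3 := hc (r - δ) (r - δ / 2) (by linarith) (by linarith)
        have e4 := hc (r - δ / 2) r (by linarith) (by linarith)
        have e5 := hc (r - δ) r (by linarith) (by linarith)
        rw [IsCAT0Space.dist_eq_of_overlap (y := c (r - δ)) (z := c (r - δ / 2))
          (dist_pos.1 (by rw [e3]; linarith)) (by rw [e1, e2, e3]; ring)
          (by rw [e3, e4, e5]; ring), e2, e4]
        ring
  have key' (s r : ℝ) (h : s ≤ r) : dist (c s) (c r) = r - s := by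
    obtain ⟨n, hn⟩ := exists_nat_ge ((r - s) / (δ / 2))
    rw [div_le_iff₀ (by positivity)] at hn
    exact key n s r h (by linarith)
  refine Isometry.of_dist_eq fun s r => ?_
  rcases le_total s r with h | h
  · rw [key' s r h, Real.dist_eq, abs_sub_comm, abs_of_nonneg (by linarith)]
  · rw [dist_comm, key' r s h, Real.dist_eq, abs_of_nonneg (by linarith)]

/-! ### Translations along geodesics and construction of axes -/

section Axis

variable {X : Type*} [MetricSpace X]

theorem IsometryEquiv.zpow_apply_geodesic {γ : X ≃ᵢ X} {c : ℝ → X} {a : ℝ}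
    (h : ∀ s, γ (c s) = c (s + a)) (k : ℤ) (s : ℝ) : (γ ^ k) (c s) = c (s + k * a) := by
  induction k generalizing s with
  | zero => simp
  | succ n ih =>
    rw [zpow_add_one, IsometryEquiv.mul_apply, h, ih]
    push_cast; ring_nf
  | pred n ih =>
    have h' : γ⁻¹ (c s) = c (s - a) := by
      rw [← γ.injective.eq_iff, IsometryEquiv.apply_inv_self, h, sub_add_cancel]
    rw [zpow_sub_one, IsometryEquiv.mul_apply, h', ih]
    push_cast; ring_nf

/-- An isometry translating a geodesic line by `a > 0` moves every point by at least `a`. -/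
theorem le_dist_of_translates {γ : X ≃ᵢ X} {c : ℝ → X} (hc : Isometry c) {a : ℝ} (ha : 0 < a)
    (h : ∀ s, γ (c s) = c (s + a)) (x : X) : a ≤ dist x (γ x) := by
  have h1 (n : ℕ) : dist x ((γ ^ n) x) ≤ n * dist x (γ x) := by
    induction n with
    | zero => simp
    | succ n ih =>
      have : dist ((γ ^ n) x) ((γ ^ (n + 1)) x) = dist x (γ x) := by
        rw [pow_succ, IsometryEquiv.mul_apply, IsometryEquiv.dist_eq]
      push_cast
      linarith [dist_triangle x ((γ ^ n) x) ((γ ^ (n + 1)) x)]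
  -- `γ ^ n` moves `c 0` by `n * a`, and `x` stays at fixed distance from the line; dividing by
  -- large `n` removes the error.
  have h2 (n : ℕ) : n * a ≤ 2 * dist x (c 0) + n * dist x (γ x) := by
    have e1 : (γ ^ n) (c 0) = c (n * a) := by
      have := IsometryEquiv.zpow_apply_geodesic h n 0
      simpa using this
    have e2 : dist (c 0) (c (n * a)) = n * a := by
      rw [hc.dist_eq, Real.dist_eq, zero_sub, abs_neg, abs_of_nonneg (by positivity)]
    have e3 : dist ((γ ^ n) x) (c (n * a)) = dist x (c 0) := by rw [← e1, IsometryEquiv.dist_eq]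
    linarith [dist_triangle4_right x (c (n * a)) (c 0) ((γ ^ n) x), h1 n,
      dist_triangle4 (c 0) x ((γ ^ n) x) (c (n * a)), dist_comm x (c 0)]
  by_contra! hlt
  obtain ⟨n, hn⟩ := exists_nat_gt (2 * dist x (c 0) / (a - dist x (γ x)))
  rw [div_lt_iff₀ (by linarith)] at hn
  linarith [h2 n]

theorem translationLength_eq {γ : X ≃ᵢ X} {c : ℝ → X} (hc : Isometry c) {a : ℝ} (ha : 0 < a)
    (h : ∀ s, γ (c s) = c (s + a)) : translationLength γ = a := by
  have h0 : dist (c 0) (γ (c 0)) = a := by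
    rw [h, hc.dist_eq, Real.dist_eq, zero_add, zero_sub, abs_neg, abs_of_pos ha]
  have : Nonempty X := ⟨c 0⟩
  refine le_antisymm ?_ (le_ciInf (le_dist_of_translates hc ha h))
  exact (ciInf_le ⟨a, by rintro _ ⟨x, rfl⟩; exact le_dist_of_translates hc ha h x⟩ (c 0)).trans h0.le

theorem isHyperbolicIsometry_of_translates {γ : X ≃ᵢ X} {c : ℝ → X} (hc : Isometry c) {a : ℝ}
    (ha : 0 < a) (h : ∀ s, γ (c s) = c (s + a)) : IsHyperbolicIsometry γ := by
  rw [IsHyperbolicIsometry, translationLength_eq hc ha h]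
  refine ⟨ha, c 0, ?_⟩
  rw [h, hc.dist_eq, Real.dist_eq, zero_add, zero_sub, abs_neg, abs_of_pos ha]

/-- An isometry moving an initial piece of a geodesic along that geodesic has an axis that
contains the geodesic segment from the piece to its image. -/
theorem exists_axis_of_translates_initial [IsCAT0Space X] {h : X ≃ᵢ X} {σ : ℝ → X}
    (hσ : Isometry σ) {a δ : ℝ} (hδ : 0 < δ) (hδa : δ ≤ a) (h0 : h (σ 0) = σ a)
    (h1 : h (σ δ) = σ (a + δ)) :
    ∃ c : ℝ → X, Isometry c ∧ (∀ s ∈ Set.Icc 0 a, c s = σ s) ∧ ∀ s, h (c s) = c (s + a) := by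
  have ha : 0 < a := hδ.trans_le hδa
  have dσ {s r : ℝ} (hsr : s ≤ r) : dist (σ s) (σ r) = r - s := by
    rw [hσ.dist_eq, Real.dist_eq, abs_sub_comm, abs_of_nonneg (by linarith)]
  have join {s r : ℝ} (hs : s ∈ Set.Icc 0 a) (hr : r ∈ Set.Icc 0 a) :
      dist (σ s) (h (σ r)) = a - s + r := by
    -- For `δ ≤ r` the two geodesics overlap in the segment from `σ a` to `σ (a + δ)`. Smaller `r`
    -- follow from the case `r = a` by the triangle inequality.
    have far {r : ℝ} (hr1 : δ ≤ r) : dist (σ s) (h (σ r)) = a - s + r := by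
      have e1 : dist (σ (a + δ)) (h (σ r)) = r - δ := by rw [← h1, h.dist_eq, dσ hr1]
      have e2 : dist (σ a) (h (σ r)) = r := by
        rw [← h0, h.dist_eq, dσ (by linarith), sub_zero]
      have e3 : dist (σ a) (σ (a + δ)) = δ := by rw [dσ (by linarith)]; ring
      have e4 : dist (σ s) (σ (a + δ)) = a + δ - s := dσ (by linarith [hs.2])
      rw [IsCAT0Space.dist_eq_of_overlap (y := σ a) (z := σ (a + δ))
        (dist_pos.1 (by rw [e3]; exact hδ)) (by rw [e3, e4, dσ hs.2]; ring)
        (by rw [e1, e2, e3]; ring), e4, e1]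
      ring
    refine le_antisymm ?_ ?_
    · have := dist_triangle (σ s) (σ a) (h (σ r))
      rw [dσ hs.2] at this
      refine this.trans (le_of_eq ?_)
      rw [← h0, h.dist_eq, dσ hr.1, sub_zero]
    · have := dist_triangle (σ s) (h (σ r)) (h (σ a))
      rw [far hδa, h.dist_eq, dσ hr.2] at this
      linarith
  -- The translates of `σ` on `[0, a)` by powers of `h`, laid end to end.
  set c : ℝ → X := fun s => (h ^ ⌊s / a⌋) (σ (s - ⌊s / a⌋ * a)) with hcdef
  have fl (s : ℝ) : 0 ≤ s - ⌊s / a⌋ * a ∧ s - ⌊s / a⌋ * a < a := by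
    have l1 := Int.floor_le (s / a)
    have l2 := Int.lt_floor_add_one (s / a)
    rw [le_div_iff₀ ha] at l1
    rw [div_lt_iff₀ ha] at l2
    constructor <;> linarith
  have trans (s : ℝ) : h (c s) = c (s + a) := by
    have : ⌊(s + a) / a⌋ = ⌊s / a⌋ + 1 := by
      rw [add_div, div_self ha.ne', Int.floor_add_one]
    simp only [hcdef, this]
    rw [add_comm ⌊s / a⌋ 1, zpow_one_add, IsometryEquiv.mul_apply]
    push_cast
    ring_nf
  -- Parameters at most `a` apart lie in the same or in consecutive pieces, where `join` applies.
  refine ⟨c, IsCAT0Space.isometry_of_local ha fun s r hsr hra => ?_, fun s hs => ?_, trans⟩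
  · have f1 := fl s
    have f2 := fl r
    have hk1 : ⌊s / a⌋ ≤ ⌊r / a⌋ := Int.floor_le_floor (by gcongr)
    have hk2 : ⌊r / a⌋ ≤ ⌊s / a⌋ + 1 := by
      rw [← Int.floor_add_one]
      refine Int.floor_le_floor ?_
      rw [← div_self ha.ne', ← add_div]
      gcongr
    rcases hk1.eq_or_lt with hk | hk
    · simp only [hcdef]
      rw [← hk, IsometryEquiv.dist_eq, dσ (by linarith)]
      ring
    · have hk' : ⌊r / a⌋ = ⌊s / a⌋ + 1 := by omega
      simp only [hcdef]
      rw [hk'] at f2 ⊢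
      rw [zpow_add_one, IsometryEquiv.mul_apply, IsometryEquiv.dist_eq,
        join ⟨f1.1, f1.2.le⟩ ⟨f2.1, f2.2.le⟩]
      push_cast
      ring
  · rcases hs.2.lt_or_eq with hlt | rfl
    · have : ⌊s / a⌋ = 0 := by
        rw [Int.floor_eq_zero_iff]
        exact ⟨div_nonneg hs.1 ha.le, (div_lt_one ha).2 hlt⟩
      simp [hcdef, this]
    · simp [hcdef, div_self ha.ne', h0]

end Axis

/-! ### Discrete orbits, pigeonhole and closing isometries -/

section Orbit

variable {X : Type*} [MetricSpace X]

theorem mem_isometryOrbit_self (G : Subgroup (X ≃ᵢ X)) (x : X) : x ∈ isometryOrbit G x :=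
  ⟨1, G.one_mem, rfl⟩

/-- A discrete orbit in a proper space meets every ball in a finite set. -/
theorem isometryOrbit_inter_closedBall_finite [ProperSpace X] (G : Subgroup (X ≃ᵢ X)) (x : X)
    [DiscreteTopology (isometryOrbit G x)] (y : X) (R : ℝ) :
    (isometryOrbit G x ∩ Metric.closedBall y R).Finite := by
  obtain ⟨ε, hε, hb⟩ : ∃ ε > 0, ∀ z ∈ isometryOrbit G x, dist z x < ε → z = x := by
    have := (Metric.isOpen_singleton_iff (α := isometryOrbit G x)
      (x := ⟨x, mem_isometryOrbit_self G x⟩)).1 (isOpen_discrete _)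
    obtain ⟨ε, hε, hb⟩ := this
    exact ⟨ε, hε, fun z hz hd => congrArg Subtype.val (hb ⟨z, hz⟩ hd)⟩
  -- The group is transitive on the orbit, so the isolation radius at `x` serves everywhere; a
  -- uniformly separated set is closed.
  have hpw : (isometryOrbit G x).Pairwise fun u v => ε ≤ dist u v := by
    rintro _ ⟨g, hg, rfl⟩ _ ⟨k, hk, rfl⟩ hne
    by_contra! hlt
    refine hne ?_
    have h1 : (g⁻¹ * k) x = x := by
      refine hb _ ⟨_, G.mul_mem (G.inv_mem hg) hk, rfl⟩ ?_
      rwa [IsometryEquiv.mul_apply, ← g.dist_eq, IsometryEquiv.apply_inv_self, dist_comm]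
    rw [IsometryEquiv.mul_apply, ← g.injective.eq_iff, IsometryEquiv.apply_inv_self] at h1
    exact h1.symm
  have hcl : IsClosed (isometryOrbit G x) := Metric.isClosed_of_pairwise_le_dist hε hpw
  exact ((isCompact_closedBall y R).inter_left hcl).finite
    (IsDiscrete.mono ⟨inferInstance⟩ Set.inter_subset_left)

theorem exists_strictMono_of_finite_range {α : Type*} {F : ℕ → α} (hF : (Set.range F).Finite) :
    ∃ φ : ℕ → ℕ, StrictMono φ ∧ ∀ m n, F (φ m) = F (φ n) := by
  have : Finite (Set.range F) := hF
  obtain ⟨y, hy⟩ := Finite.exists_infinite_fiber (Set.rangeFactorization F)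
  rw [Set.infinite_coe_iff] at hy
  obtain ⟨φ, hφ, h⟩ := extraction_of_frequently_atTop (Nat.frequently_atTop_iff_infinite.2 hy)
  refine ⟨φ, hφ, fun m n => ?_⟩
  exact congrArg Subtype.val ((h m).trans (h n).symm)

/-- Along a subsequence, any point of the sequence and its successor can be carried simultaneously
to any other such pair by an element of the group. -/
theorem exists_strictMono_carrying [ProperSpace X] (G : Subgroup (X ≃ᵢ X)) (x : ℕ → X)
    (hbdd : BddAbove (Set.range fun n => dist (x n) (x (n + 1))))
    (h_orbits : (Set.range fun n => isometryOrbit G (x n)).Finite)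
    (h_discrete : ∀ n, DiscreteTopology (isometryOrbit G (x n))) :
    ∃ f : ℕ → ℕ, StrictMono f ∧
      ∀ m n, ∃ h ∈ G, h (x (f m)) = x (f n) ∧ h (x (f m + 1)) = x (f n + 1) := by
  obtain ⟨φ, hφ, hφo⟩ := exists_strictMono_of_finite_range h_orbits
  obtain ⟨C, hC⟩ := hbdd
  have hmem (n : ℕ) : ∃ g ∈ G, g (x (φ 0)) = x (φ n) := by
    change x (φ n) ∈ isometryOrbit G (x (φ 0))
    rw [hφo 0 n]
    exact mem_isometryOrbit_self G _
  choose g hg hgx using hmem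
  -- Pulled back to the base point `x (φ 0)`, all successors lie in one ball and in finitely many
  -- discrete orbits.
  have hfin : (Set.range fun n => (g n)⁻¹ (x (φ n + 1))).Finite := by
    refine (Set.Finite.biUnion h_orbits (t := fun O => O ∩ Metric.closedBall (x (φ 0)) C)
      ?_).subset ?_
    · rintro _ ⟨n, rfl⟩
      have := h_discrete n
      exact isometryOrbit_inter_closedBall_finite G _ _ _
    · rintro _ ⟨n, rfl⟩
      refine Set.mem_biUnion ⟨φ n + 1, rfl⟩ ⟨⟨_, G.inv_mem (hg n), rfl⟩, ?_⟩
      rw [Metric.mem_closedBall, ← (g n).dist_eq, IsometryEquiv.apply_inv_self, hgx, dist_comm]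
      exact hC ⟨φ n, rfl⟩
  obtain ⟨ψ, hψ, hψe⟩ := exists_strictMono_of_finite_range hfin
  refine ⟨φ ∘ ψ, hφ.comp hψ, fun m n => ⟨g (ψ n) * (g (ψ m))⁻¹,
    G.mul_mem (hg _) (G.inv_mem (hg _)), ?_, ?_⟩⟩
  · rw [IsometryEquiv.mul_apply, Function.comp_apply, ← hgx (ψ m),
      IsometryEquiv.inv_apply_self, hgx]; rfl
  · have := hψe m n
    rw [IsometryEquiv.mul_apply, Function.comp_apply, this, IsometryEquiv.apply_inv_self]; rfl

end Orbit

/-- An isometry carrying a consecutive pair of points of `ρ` to another makes the two gaps equal. It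
therefore moves the initial piece of the segment along `ρ`, and the piece is no longer than the
segment because the indices increase. -/
theorem exists_closing_subsequence {X : Type*} [MetricSpace X] [ProperSpace X] [IsCAT0Space X]
    (G : Subgroup (X ≃ᵢ X)) (ρ : ℝ → X) (hρ : Isometry ρ)
    (t : ℕ → ℝ) (ht_mono : StrictMono t)
    (ht_bdd : BddAbove (Set.range fun n => dist (ρ (t n)) (ρ (t (n + 1)))))
    (h_orbits : (Set.range fun n => isometryOrbit G (ρ (t n))).Finite)
    (h_discrete : ∀ n, DiscreteTopology (isometryOrbit G (ρ (t n)))) :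
    ∃ f : ℕ → ℕ, StrictMono f ∧ (∀ n, 0 < f n) ∧
      ∀ m n : ℕ, m < n → ∃ h ∈ G, IsClosingIsometry ρ (t (f m)) (t (f n)) h := by
  obtain ⟨f, hf, hfh⟩ := exists_strictMono_carrying G (fun n => ρ (t n)) ht_bdd h_orbits h_discrete
  -- The shift by one makes all values positive.
  refine ⟨fun n => f (n + 1), fun m n hmn => hf (by omega),
    fun n => (Nat.zero_le _).trans_lt (hf n.succ_pos), fun m n hmn => ?_⟩
  obtain ⟨h, hG, h0, h1⟩ := hfh (m + 1) (n + 1)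
  set p := t (f (m + 1))
  set q := t (f (n + 1))
  have hfl : f (m + 1) + 1 ≤ f (n + 1) := hf (by omega)
  have hle : t (f (m + 1) + 1) ≤ q := ht_mono.monotone hfl
  have hlt : p < t (f (m + 1) + 1) := ht_mono (Nat.lt_succ_self _)
  have hlt' : q < t (f (n + 1) + 1) := ht_mono (Nat.lt_succ_self _)
  have hδ : t (f (n + 1) + 1) - q = t (f (m + 1) + 1) - p := by
    have := h.dist_eq (ρ p) (ρ (t (f (m + 1) + 1)))
    rw [h0, h1, hρ.dist_eq, hρ.dist_eq, Real.dist_eq, Real.dist_eq, abs_sub_comm,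
      abs_of_pos (by linarith), abs_sub_comm, abs_of_pos (by linarith)] at this
    exact this
  obtain ⟨c, hc, hcσ, hch⟩ := exists_axis_of_translates_initial (h := h) (a := q - p)
    (δ := t (f (m + 1) + 1) - p) (σ := fun s => ρ (s + p))
    (hρ.comp (isometry_add_right p)) (by linarith) (by linarith)
    (by simpa using h0) (by
      simp only [sub_add_cancel]
      rw [h1]
      congr 1
      linarith)
  have ha : 0 < q - p := by linarith
  refine ⟨h, hG, isHyperbolicIsometry_of_translates hc ha hch, Set.range c,
    ⟨c, hc, rfl, _, ha, hch⟩, ?_⟩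
  rintro _ ⟨s, hs, rfl⟩
  refine ⟨s - p, ?_⟩
  rw [hcσ _ ⟨by linarith [hs.1], by linarith [hs.2]⟩, sub_add_cancel]

/-! ### Midpoint-convex functions on the line -/

section MidpointConvex

/-- Increments over successive steps of size `T` do not decrease. Hence a single strict increase
forces linear growth, which contradicts boundedness. -/
theorem midpointConvex_growth {f : ℝ → ℝ} (hf : ∀ s T, 2 * f s ≤ f (s + T) + f (s - T))
    (s T : ℝ) (n : ℕ) : f s + n * (f (s + T) - f s) ≤ f (s + n * T) := by
  have inc (n : ℕ) : f (s + T) - f s ≤ f (s + (n + 1) * T) - f (s + n * T) := by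
    induction n with
    | zero => simp
    | succ n ih =>
      have := hf (s + (n + 1) * T) T
      rw [show s + (n + 1) * T + T = s + (n + 1 + 1) * T by ring,
        show s + (n + 1) * T - T = s + n * T by ring] at this
      push_cast
      linarith
  induction n with
  | zero => simp
  | succ n ih =>
    push_cast
    linarith [inc n]

theorem midpointConvex_eq_of_bddAbove {f : ℝ → ℝ} (hf : ∀ s T, 2 * f s ≤ f (s + T) + f (s - T))
    {K : ℝ} (hK : ∀ s, f s ≤ K) (s r : ℝ) : f s = f r := by
  have key (s r : ℝ) : f r ≤ f s := by
    by_contra! hlt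
    obtain ⟨n, hn⟩ := exists_nat_gt ((K - f s) / (f r - f s))
    rw [div_lt_iff₀ (by linarith)] at hn
    have := midpointConvex_growth hf s (r - s) n
    rw [add_sub_cancel] at this
    linarith [hK (s + n * (r - s))]
  exact le_antisymm (key r s) (key s r)

/-- Jensen's equation makes `f - f 0` additive, and continuity makes it linear. -/
theorem exists_affine_of_midpoint {f : ℝ → ℝ} (hc : Continuous f)
    (hf : ∀ s T, f (s + T) + f (s - T) = 2 * f s) : ∃ α, ∀ s, f s = α * s + f 0 := by
  have hadd (x y : ℝ) : f (x + y) - f 0 = (f x - f 0) + (f y - f 0) := by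
    have h1 := hf ((x + y) / 2) ((x - y) / 2)
    have h2 := hf ((x + y) / 2) ((x + y) / 2)
    ring_nf at h1 h2 ⊢
    linarith
  let A : ℝ →+ ℝ := ⟨⟨fun s => f s - f 0, sub_self _⟩, hadd⟩
  have hA : Continuous A := hc.sub continuous_const
  refine ⟨A 1, fun s => ?_⟩
  have : A s = s * A 1 := by simpa using (A.toRealLinearMap hA).map_smul s 1
  have h' : A s = f s - f 0 := rfl
  linarith

end MidpointConvex

/-! ### The flat strip theorem -/

section Strip

variable {X : Type*} [MetricSpace X] [IsCAT0Space X]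

/-- The distance along the two lines is midpoint-convex and bounded above, hence constant. -/
theorem dist_parallel_const {c c' : ℝ → X} (hc : Isometry c) (hc' : Isometry c') {K : ℝ}
    (hK : ∀ s, dist (c s) (c' s) ≤ K) (u s r : ℝ) :
    dist (c s) (c' (s + u)) = dist (c r) (c' (r + u)) := by
  refine midpointConvex_eq_of_bddAbove (f := fun s => dist (c s) (c' (s + u))) (K := K + |u|)
    (fun s T => ?_) (fun s => ?_) s r
  · have := IsCAT0Space.dist_midpoint_le hc hc' (s + T) (s - T) (s + T + u) (s - T + u)
    rw [show (s + T + (s - T)) / 2 = s by ring,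
      show (s + T + u + (s - T + u)) / 2 = s + u by ring] at this
    linarith
  · have := dist_triangle (c s) (c' s) (c' (s + u))
    rw [hc'.dist_eq, Real.dist_eq, show s - (s + u) = -u by ring, abs_neg] at this
    linarith [hK s]

/-- Distances between two parallel lines in a `CAT(0)` space are Euclidean. -/
theorem exists_dist_sq_parallel {c c' : ℝ → X} (hc : Isometry c) (hc' : Isometry c') {K : ℝ}
    (hK : ∀ s, dist (c s) (c' s) ≤ K) :
    ∃ β w : ℝ, 0 ≤ w ∧ ∀ s r, dist (c s) (c' r) ^ 2 = (r - s + β) ^ 2 + w ^ 2 := by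
  set D : ℝ → ℝ := fun u => dist (c 0) (c' u)
  have hDc (s u : ℝ) : dist (c s) (c' (s + u)) = D u := by
    rw [dist_parallel_const hc hc' hK u s 0, zero_add]
  have hDc' (s r : ℝ) : dist (c s) (c' r) = D (r - s) := by
    rw [← hDc s, add_sub_cancel]
  have hcont : Continuous D := continuous_const.dist hc'.continuous
  -- The quadrilateral inequality makes `D s ^ 2 - s ^ 2` midpoint-concave.
  have hconc (s T : ℝ) :
      D (s + T) ^ 2 - (s + T) ^ 2 + (D (s - T) ^ 2 - (s - T) ^ 2) ≤ 2 * (D s ^ 2 - s ^ 2) := by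
    have := IsCAT0Space.quadrilateral (c 0) (c T) (c' (s + T)) (c' s)
    rw [hc.dist_eq, hc'.dist_eq, dist_comm (c' s) (c 0), hDc', hDc', hDc', hDc', Real.dist_eq,
      Real.dist_eq, sq_abs, sq_abs] at this
    ring_nf at this ⊢
    linarith
  have hB (s : ℝ) : |D s - (|s|)| ≤ D 0 := by
    have e : dist (c' 0) (c' s) = |s| := by rw [hc'.dist_eq, Real.dist_eq, zero_sub, abs_neg]
    rw [abs_le]
    constructor
    · have := dist_triangle (c' 0) (c 0) (c' s)
      rw [e, dist_comm (c' 0)] at this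
      linarith
    · have := dist_triangle (c 0) (c' 0) (c' s)
      rw [e] at this
      linarith
  have hsum (s r : ℝ) : s + r ≤ D s + D (-r) := by
    have := dist_triangle (c 0) (c' s) (c (s + r))
    rw [hc.dist_eq, dist_comm (c' s), hDc', hDc', Real.dist_eq] at this
    ring_nf at this
    rw [abs_sub_comm, sub_neg_eq_add] at this
    linarith [le_abs_self (r + s)]
  set E : ℝ → ℝ := fun s => D s ^ 2 - s ^ 2 with hE
  -- A bound independent of `T`: the terms growing with `T` combine to `2 * T * (x + y)`, and `x +
  -- y` is nonnegative by the triangle inequality `hsum`. A strict concavity defect would violate it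
  -- for large `T`, so `E` is affine.
  have hlow (s T : ℝ) (hT : |s| ≤ T) : -(4 * |s| * D 0) ≤ E (s + T) + E (s - T) := by
    have hs := abs_le.1 hT
    have hx := abs_le.1 (abs_of_nonneg (a := s + T) (by linarith) ▸ hB (s + T))
    have hy := abs_le.1 (abs_of_nonpos (a := s - T) (by linarith) ▸ hB (s - T))
    have hxy := hsum (s + T) (T - s)
    rw [neg_sub] at hxy
    obtain ⟨x, hx'⟩ : ∃ x, D (s + T) = s + T + x := ⟨_, (add_sub_cancel _ _).symm⟩
    obtain ⟨y, hy'⟩ : ∃ y, D (s - T) = T - s + y := ⟨_, (add_sub_cancel _ _).symm⟩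
    rw [hx'] at hx hxy
    rw [hy'] at hy hxy
    have h1 : 0 ≤ T * (x + y) := mul_nonneg ((abs_nonneg s).trans hT) (by linarith)
    have h2 : |s * (x - y)| ≤ |s| * (2 * D 0) := by
      rw [abs_mul]
      gcongr
      rw [abs_le]
      constructor <;> linarith
    have h3 := (abs_le.1 h2).1
    simp only [hE, hx', hy']
    nlinarith [sq_nonneg x, sq_nonneg y]
  have main (s T : ℝ) (hT : 0 < T) : 2 * E s ≤ E (s + T) + E (s - T) := by
    have hfc : ∀ s T, 2 * -E s ≤ -E (s + T) + -E (s - T) := fun s T => by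
      simp only [hE]; linarith [hconc s T]
    by_contra! hlt
    obtain ⟨n, hn⟩ := exists_nat_gt
      (max ((2 * E s + 4 * |s| * D 0) / (2 * E s - E (s + T) - E (s - T))) (|s| / T))
    obtain ⟨hn1, hn2⟩ := max_lt_iff.1 hn
    rw [div_lt_iff₀ (by linarith)] at hn1
    rw [div_lt_iff₀ hT] at hn2
    have g1 := midpointConvex_growth hfc s T n
    have g2 := midpointConvex_growth hfc s (-T) n
    rw [mul_neg, ← sub_eq_add_neg, ← sub_eq_add_neg] at g2
    linarith [hlow s (n * T) hn2.le]
  have heq (s T : ℝ) : E (s + T) + E (s - T) = 2 * E s := by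
    refine le_antisymm (by simp only [hE]; linarith [hconc s T]) ?_
    rcases lt_trichotomy T 0 with hT | rfl | hT
    · have := main s (-T) (by linarith)
      rw [sub_neg_eq_add, ← sub_eq_add_neg] at this
      linarith
    · rw [add_zero, sub_zero]; linarith
    · exact main s T hT
  obtain ⟨α, hα⟩ := exists_affine_of_midpoint (f := E) (by fun_prop) heq
  have hD2 (s : ℝ) : D s ^ 2 = (s + α / 2) ^ 2 + (E 0 - (α / 2) ^ 2) := by
    have := hα s
    have h' : E s = D s ^ 2 - s ^ 2 := rfl
    linear_combination this - h'
  have hw : 0 ≤ E 0 - (α / 2) ^ 2 := by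
    have := hD2 (-(α / 2))
    rw [neg_add_cancel] at this
    nlinarith [sq_nonneg (D (-(α / 2)))]
  exact ⟨α / 2, Real.sqrt (E 0 - (α / 2) ^ 2), Real.sqrt_nonneg _, fun s r => by
    rw [hDc', hD2, Real.sq_sqrt hw]⟩

/-- Two lines at Euclidean distances from each other span a flat strip. -/
theorem exists_flatStrip {c c' : ℝ → X} {w : ℝ} (hw : 0 < w)
    (hc : Isometry c) (hc' : Isometry c')
    (h : ∀ s r, dist (c s) (c' r) ^ 2 = (r - s) ^ 2 + w ^ 2) :
    ∃ φ : ℝ → ℝ → X, (∀ s, φ s 0 = c s) ∧ ∀ s r, ∀ u ∈ Set.Icc 0 w, ∀ v ∈ Set.Icc 0 w,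
      dist (φ s u) (φ r v) ^ 2 = (s - r) ^ 2 + (u - v) ^ 2 := by
  have hd (s : ℝ) : dist (c s) (c' s) = w := by
    have := h s s
    rw [sub_self, zero_pow two_ne_zero, zero_add] at this
    exact (sq_eq_sq₀ dist_nonneg hw.le).1 this
  have hex (s u : ℝ) : ∃ x, u ∈ Set.Icc 0 w → dist (c s) x = u ∧ dist x (c' s) = w - u := by
    by_cases hu : u ∈ Set.Icc 0 w
    · obtain ⟨x, h1, h2⟩ := IsCAT0Space.exists_between (c s) (c' s) (u := u / w)
        ⟨div_nonneg hu.1 hw.le, (div_le_one hw).2 hu.2⟩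
      rw [hd] at h1 h2
      exact ⟨x, fun _ => ⟨by rw [h1]; field_simp, by rw [h2]; field_simp⟩⟩
    · exact ⟨c s, fun h => (hu h).elim⟩
  -- `φ s u` is the point at height `u` on the segment from `c s` to `c' s`.
  choose φ hφ using hex
  have cn (s : ℝ) {u : ℝ} (hu : u ∈ Set.Icc 0 w) (z : X) : w * dist (φ s u) z ^ 2 ≤
      (w - u) * dist (c s) z ^ 2 + u * dist (c' s) z ^ 2 - u * (w - u) * w := by
    have := IsCAT0Space.dist_sq_le_of_between (p := c s) (q := c' s) (r := z) (x := φ s u)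
      (u := u / w) ⟨div_nonneg hu.1 hw.le, (div_le_one hw).2 hu.2⟩
      (by rw [hd, (hφ s u hu).1]; field_simp) (by rw [hd, (hφ s u hu).2]; field_simp)
    rw [hd] at this
    have := mul_le_mul_of_nonneg_left this hw.le
    refine this.trans (le_of_eq ?_)
    field_simp
  have sqc {c : ℝ → X} (hc : Isometry c) (s r : ℝ) : dist (c s) (c r) ^ 2 = (s - r) ^ 2 := by
    rw [hc.dist_eq, Real.dist_eq, sq_abs]
  have up0 (s r : ℝ) {u : ℝ} (hu : u ∈ Set.Icc 0 w) :
      dist (φ s u) (c r) ^ 2 ≤ (s - r) ^ 2 + u ^ 2 := by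
    have := cn s hu (c r)
    rw [sqc hc, dist_comm (c' s), h] at this
    refine le_of_mul_le_mul_left (this.trans (le_of_eq ?_)) hw
    ring
  have up1 (s r : ℝ) {u : ℝ} (hu : u ∈ Set.Icc 0 w) :
      dist (φ s u) (c' r) ^ 2 ≤ (s - r) ^ 2 + (w - u) ^ 2 := by
    have := cn s hu (c' r)
    rw [sqc hc', h] at this
    refine le_of_mul_le_mul_left (this.trans (le_of_eq ?_)) hw
    ring
  have up (s r : ℝ) {u v : ℝ} (hu : u ∈ Set.Icc 0 w) (hv : v ∈ Set.Icc 0 w) :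
      dist (φ s u) (φ r v) ^ 2 ≤ (s - r) ^ 2 + (u - v) ^ 2 := by
    have h1 := cn r hv (φ s u)
    rw [dist_comm (φ r v), dist_comm (c r), dist_comm (c' r)] at h1
    have h2 := mul_le_mul_of_nonneg_left (up0 s r hu) (sub_nonneg.2 hv.2)
    have h3 := mul_le_mul_of_nonneg_left (up1 s r hu) hv.1
    refine le_of_mul_le_mul_left (a := w) ?_ hw
    linarith
  -- The Euclidean segment from `(s, u)` to `(r, v)` is prolonged to both boundary lines, where
  -- distances are exact. The upper bounds on the two end pieces then bound the middle one from
  -- below; `k` is the slope and `l` the length per unit height.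
  have lowlt (s r : ℝ) {u v : ℝ} (hu : u ∈ Set.Icc 0 w) (hv : v ∈ Set.Icc 0 w) (huv : u < v) :
      Real.sqrt ((s - r) ^ 2 + (u - v) ^ 2) ≤ dist (φ s u) (φ r v) := by
    obtain ⟨k, hk⟩ : ∃ k, r - s = k * (v - u) := ⟨(r - s) / (v - u), by
      have : v - u ≠ 0 := by linarith
      field_simp⟩
    have hl : Real.sqrt (k ^ 2 + 1) ^ 2 = k ^ 2 + 1 := Real.sq_sqrt (by positivity)
    set l := Real.sqrt (k ^ 2 + 1)
    have hl0 : 0 ≤ l := Real.sqrt_nonneg _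
    have e0 : dist (c (s - k * u)) (c' (r + k * (w - v))) = w * l := by
      refine (sq_eq_sq₀ dist_nonneg (by positivity)).1 ?_
      rw [h, mul_pow, hl]
      have : r = s + k * (v - u) := by linarith
      rw [this]; ring
    have e1 : dist (c (s - k * u)) (φ s u) ≤ u * l := by
      rw [dist_comm]
      refine le_of_sq_le_sq ((up0 s _ hu).trans (le_of_eq ?_)) (mul_nonneg hu.1 hl0)
      rw [mul_pow, hl]; ring
    have e2 : dist (φ r v) (c' (r + k * (w - v))) ≤ (w - v) * l := by
      refine le_of_sq_le_sq ((up1 r _ hv).trans (le_of_eq ?_))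
        (mul_nonneg (sub_nonneg.2 hv.2) hl0)
      rw [mul_pow, hl]; ring
    have e3 : Real.sqrt ((s - r) ^ 2 + (u - v) ^ 2) = (v - u) * l := by
      rw [Real.sqrt_eq_iff_eq_sq (by positivity) (mul_nonneg (by linarith) hl0), mul_pow, hl]
      have : r = s + k * (v - u) := by linarith
      rw [this]; ring
    have := dist_triangle4 (c (s - k * u)) (φ s u) (φ r v) (c' (r + k * (w - v)))
    rw [e3]
    linarith
  have lowne (s r : ℝ) {u v : ℝ} (hu : u ∈ Set.Icc 0 w) (hv : v ∈ Set.Icc 0 w) (huv : u ≠ v) :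
      Real.sqrt ((s - r) ^ 2 + (u - v) ^ 2) ≤ dist (φ s u) (φ r v) := by
    rcases huv.lt_or_gt with huv | huv
    · exact lowlt s r hu hv huv
    · have := lowlt r s hv hu huv
      rwa [dist_comm, ← neg_sub s r, ← neg_sub u v, neg_sq, neg_sq] at this
  have low (s r : ℝ) {u v : ℝ} (hu : u ∈ Set.Icc 0 w) (hv : v ∈ Set.Icc 0 w) :
      Real.sqrt ((s - r) ^ 2 + (u - v) ^ 2) ≤ dist (φ s u) (φ r v) := by
    rcases ne_or_eq u v with huv | rfl
    · exact lowne s r hu hv huv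
    · rw [sub_self, zero_pow two_ne_zero, add_zero, Real.sqrt_sq_eq_abs]
      -- Equal heights are reached by perturbing one height by at most `ε`.
      refine le_of_forall_pos_le_add fun ε hε => ?_
      obtain ⟨v, hv, hne, hvε⟩ : ∃ v ∈ Set.Icc 0 w, u ≠ v ∧ |u - v| ≤ ε := by
        rcases hu.1.eq_or_lt with h0 | h0
        · refine ⟨min w ε, ⟨by positivity, min_le_left _ _⟩, ?_, ?_⟩
          · rw [← h0]; exact (lt_min hw hε).ne
          · rw [← h0, zero_sub, abs_neg, abs_of_pos (lt_min hw hε)]; exact min_le_right _ _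
        · refine ⟨max 0 (u - ε), ⟨le_max_left _ _, ?_⟩, ?_, ?_⟩
          · exact max_le hw.le (by linarith [hu.2])
          · exact (max_lt h0 (by linarith)).ne'
          · rw [abs_of_nonneg (sub_nonneg.2 (max_le hu.1 (by linarith)))]
            linarith [le_max_right 0 (u - ε)]
      have h1 : |s - r| ≤ Real.sqrt ((s - r) ^ 2 + (u - v) ^ 2) := by
        rw [← Real.sqrt_sq_eq_abs]
        exact Real.sqrt_le_sqrt (by nlinarith [sq_nonneg (u - v)])
      have h2 : dist (φ r u) (φ r v) ≤ |u - v| := by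
        refine le_of_sq_le_sq ((up r r hu hv).trans (le_of_eq ?_)) (abs_nonneg _)
        rw [sq_abs]; ring
      linarith [lowne s r hu hv hne, dist_triangle (φ s u) (φ r u) (φ r v)]
  refine ⟨φ, fun s => ?_, fun s r u hu v hv => le_antisymm (up s r hu hv) ?_⟩
  · exact (dist_eq_zero.1 (hφ s 0 ⟨le_rfl, hw.le⟩).1).symm
  · refine (Real.sqrt_le_left dist_nonneg).1 ?_
    exact low s r hu hv

end Strip

/-! ### Limits and transfer of flat half-planes -/

section HalfPlane

variable {X : Type*} [MetricSpace X]

/-- In a proper space, partial flat half-planes with the same boundary line, exhausting the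
half-plane, subconverge to a flat half-plane. -/
theorem boundsFlatHalfPlane_of_eventually [ProperSpace X] {c : ℝ → X} (φ : ℕ → ℝ → ℝ → X)
    (hφ : ∀ s r u v, 0 ≤ u → 0 ≤ v →
      ∀ᶠ n in atTop, dist (φ n s u) (φ n r v) ^ 2 = (s - r) ^ 2 + (u - v) ^ 2)
    (hφc : ∀ s, ∀ᶠ n in atTop, φ n s 0 = c s) : BoundsFlatHalfPlane (Set.range c) := by
  -- Limits along a nonprincipal ultrafilter exist at all points at once, with no diagonal
  -- extraction.
  have hU : (hyperfilter ℕ : Filter ℕ) ≤ atTop := by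
    rw [← Nat.cofinite_eq_atTop]; exact hyperfilter_le_cofinite
  have hex (p : EuclideanSpace ℝ (Fin 2)) : ∃ x, p ∈ euclideanHalfPlane →
      Tendsto (fun n => φ n (p 0) (p 1)) (hyperfilter ℕ) (𝓝 x) := by
    by_cases hp : p ∈ euclideanHalfPlane
    · have hball : ∀ᶠ n in atTop, φ n (p 0) (p 1) ∈
          Metric.closedBall (c 0) (Real.sqrt ((p 0 - 0) ^ 2 + (p 1 - 0) ^ 2)) := by
        filter_upwards [hφ (p 0) 0 (p 1) 0 hp le_rfl, hφc 0] with n h1 h2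
        rw [Metric.mem_closedBall, ← h2, ← h1, Real.sqrt_sq dist_nonneg]
      obtain ⟨x, -, hx⟩ := (isCompact_closedBall _ _).ultrafilter_le_nhds
        ((hyperfilter ℕ).map fun n => φ n (p 0) (p 1)) (le_principal_iff.2 (hU hball))
      exact ⟨x, fun _ => hx⟩
    · exact ⟨c 0, fun h => (hp h).elim⟩
  choose Φ hΦ using hex
  have hbd (p : EuclideanSpace ℝ (Fin 2)) (hp : p ∈ euclideanHalfPlaneBoundary) :
      Φ p = c (p 0) := by
    have hp1 : p 1 = 0 := hp
    have h1 := hΦ p hp1.ge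
    rw [hp1] at h1
    exact tendsto_nhds_unique h1 (tendsto_const_nhds.congr'
      ((hφc (p 0)).filter_mono hU |>.mono fun n hn => hn.symm))
  refine ⟨Φ, fun p hp q hq => ?_, ?_⟩
  · have h1 := ((hΦ p hp).dist (hΦ q hq)).pow 2
    have h2 : Tendsto (fun n => dist (φ n (p 0) (p 1)) (φ n (q 0) (q 1)) ^ 2) (hyperfilter ℕ)
        (𝓝 (dist p q ^ 2)) := by
      rw [dist_sq_euclideanPlane]
      exact tendsto_const_nhds.congr'
        ((hφ (p 0) (q 0) (p 1) (q 1) hp hq).filter_mono hU |>.mono fun n hn => hn.symm)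
    exact (sq_eq_sq₀ dist_nonneg dist_nonneg).1 (tendsto_nhds_unique h1 h2)
  · ext x
    constructor
    · rintro ⟨p, hp, rfl⟩
      exact ⟨p 0, (hbd p hp).symm⟩
    · rintro ⟨s, rfl⟩
      exact ⟨!₂[s, 0], by simp [euclideanHalfPlaneBoundary],
        by rw [hbd _ (by simp [euclideanHalfPlaneBoundary])]; simp⟩

/-- A geodesic contained in a geodesic line differs from it by an isometry of the parameter. -/
theorem exists_reparametrization {c σ : ℝ → X} (hc : Isometry c) (hσ : Isometry σ) {S : Set ℝ}
    {l r : ℝ} (hl : l ∈ S) (hr : r ∈ S) (hlr : l < r) (h : σ '' S ⊆ Set.range c) :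
    ∃ ε τ : ℝ, (ε = 1 ∨ ε = -1) ∧ ∀ s ∈ S, σ s = c (ε * s + τ) := by
  have hex (s : ℝ) : ∃ u, s ∈ S → c u = σ s := by
    by_cases hs : s ∈ S
    · obtain ⟨u, hu⟩ := h ⟨s, hs, rfl⟩
      exact ⟨u, fun _ => hu⟩
    · exact ⟨0, fun h => (hs h).elim⟩
  choose u hu using hex
  have hd {s r : ℝ} (hs : s ∈ S) (hr : r ∈ S) : (u s - u r) ^ 2 = (s - r) ^ 2 := by
    have := hc.dist_eq (u s) (u r)
    rw [hu s hs, hu r hr, hσ.dist_eq, Real.dist_eq, Real.dist_eq] at this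
    rw [← sq_abs, ← this, sq_abs]
  have hε : ∃ ε : ℝ, (ε = 1 ∨ ε = -1) ∧ u r - u l = ε * (r - l) := by
    rcases sq_eq_sq_iff_eq_or_eq_neg.1 (hd hr hl) with h | h
    · exact ⟨1, .inl rfl, by linarith⟩
    · exact ⟨-1, .inr rfl, by linarith⟩
  obtain ⟨ε, hε, hul⟩ := hε
  have hε2 : ε ^ 2 = 1 := by rcases hε with rfl | rfl <;> norm_num
  refine ⟨ε, u l - ε * l, hε, fun s hs => ?_⟩
  rw [← hu s hs]
  congr 1
  have h1 := hd hs hl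
  have h2 := hd hs hr
  -- The distances to both `l` and `r` determine the position on the line.
  have h3 : (r - l) * (u s - u l - ε * (s - l)) = 0 := by
    have : u r = u l + ε * (r - l) := by linarith
    rw [this] at h2
    have h4 : ε * ((r - l) * (u s - u l - ε * (s - l))) = 0 := by
      linear_combination (1 / 2) * h1 - (1 / 2) * h2 + (1 / 2 * (r - l) ^ 2 -
        (r - l) * (s - l)) * hε2
    rcases mul_eq_zero.1 h4 with h | h
    · rw [h] at hε2; norm_num at hε2
    · exact h
  rcases mul_eq_zero.1 h3 with h | h <;> linarith

/-- Translating or reflecting the first coordinate preserves the half-plane, so that coordinate can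
be matched with the parameter of `σ`. -/
theorem BoundsFlatHalfPlane.exists_coordinates {L : Set X} (hL : BoundsFlatHalfPlane L)
    {σ : ℝ → X} (hσ : Isometry σ) {S : Set ℝ} {l r : ℝ} (hl : l ∈ S) (hr : r ∈ S) (hlr : l < r)
    (h : σ '' S ⊆ L) : ∃ ψ : ℝ → ℝ → X, (∀ s ∈ S, ψ s 0 = σ s) ∧ ∀ s r u v, 0 ≤ u → 0 ≤ v →
      dist (ψ s u) (ψ r v) ^ 2 = (s - r) ^ 2 + (u - v) ^ 2 := by
  obtain ⟨φ, hφ, hφL⟩ := hL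
  have hd (s r u v : ℝ) (hu : 0 ≤ u) (hv : 0 ≤ v) :
      dist (φ !₂[s, u]) (φ !₂[r, v]) ^ 2 = (s - r) ^ 2 + (u - v) ^ 2 := by
    rw [hφ _ (by simpa [euclideanHalfPlane] using hu) _ (by simpa [euclideanHalfPlane] using hv),
      dist_sq_euclideanPlane]
    simp
  have hc : Isometry fun s => φ !₂[s, 0] := by
    refine Isometry.of_dist_eq fun s r => (sq_eq_sq₀ dist_nonneg dist_nonneg).1 ?_
    rw [hd _ _ _ _ le_rfl le_rfl, Real.dist_eq, sq_abs]
    ring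
  have hsub : σ '' S ⊆ Set.range fun s => φ !₂[s, 0] := by
    refine h.trans ?_
    rw [← hφL]
    rintro _ ⟨p, hp, rfl⟩
    have hp1 : p 1 = 0 := hp
    refine ⟨p 0, ?_⟩
    simp only
    congr 1
    ext i
    fin_cases i <;> simp [hp1]
  obtain ⟨ε, τ, hε, hσc⟩ := exists_reparametrization hc hσ hl hr hlr hsub
  have hε2 : ε ^ 2 = 1 := by rcases hε with rfl | rfl <;> norm_num
  refine ⟨fun s u => φ !₂[ε * s + τ, u], fun s hs => (hσc s hs).symm, fun s r u v hu hv => ?_⟩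
  rw [hd _ _ _ _ hu hv]
  linear_combination (s - r) ^ 2 * hε2

/-- A line invariant under a translation bounds a flat half-plane as soon as arbitrarily long
segments of it lie on lines that do. -/
theorem boundsFlatHalfPlane_of_segments [ProperSpace X] {g : X ≃ᵢ X} {ρ : ℝ → X}
    (hρ : Isometry ρ) {b : ℝ} (hb : b ≠ 0) (hg : ∀ s, g (ρ s) = ρ (s + b))
    (h : ∀ R : ℝ, ∃ l r L, R ≤ r - l ∧ ρ '' Set.Icc l r ⊆ L ∧ BoundsFlatHalfPlane L) :
    BoundsFlatHalfPlane (Set.range ρ) := by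
  choose l r L hlr hsub hL using fun n : ℕ => h (n + 1)
  have hlt (n : ℕ) : l n < r n := by
    have := hlr n
    have h0 : (0 : ℝ) ≤ n := n.cast_nonneg
    linarith
  choose ψ hψ0 hψ using fun n => (hL n).exists_coordinates hρ
    (Set.left_mem_Icc.2 (hlt n).le) (Set.right_mem_Icc.2 (hlt n).le) (hlt n) (hsub n)
  -- `g ^ (-k n)` brings the middle of the `n`-th segment within `|b|` of parameter `0`.
  let k : ℕ → ℤ := fun n => ⌊(l n + r n) / 2 / b⌋
  have hk (n : ℕ) : |(l n + r n) / 2 - k n * b| ≤ |b| := by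
    have : (l n + r n) / 2 - k n * b = Int.fract ((l n + r n) / 2 / b) * b := by
      rw [Int.fract, sub_mul, div_mul_cancel₀ _ hb]
    rw [this, abs_mul, abs_of_nonneg (Int.fract_nonneg _)]
    exact mul_le_of_le_one_left (abs_nonneg _) (Int.fract_lt_one _).le
  refine boundsFlatHalfPlane_of_eventually (fun n s u => (g ^ (-k n)) (ψ n (s + k n * b) u))
    (fun s r u v hu hv => Eventually.of_forall fun n => ?_) fun s => ?_
  · rw [IsometryEquiv.dist_eq, hψ n _ _ _ _ hu hv]
    ring
  · filter_upwards [eventually_ge_atTop ⌈2 * (|s| + |b|)⌉₊] with n hn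
    have hn' := Nat.ceil_le.1 hn
    have h1 := abs_le.1 (hk n)
    have h2 := hlr n
    have h3 := neg_abs_le s
    have h4 := le_abs_self s
    rw [hψ0 n _ ⟨by linarith, by linarith⟩, IsometryEquiv.zpow_apply_geodesic hg]
    push_cast
    ring_nf

/-- If one axis of an isometry bounds a flat half-plane, then so does every axis. -/
theorem BoundsFlatHalfPlane.of_isTranslationAxis [ProperSpace X] [IsCAT0Space X] {g : X ≃ᵢ X}
    {L L' : Set X} (hL : IsTranslationAxis g L) (hL' : IsTranslationAxis g L')
    (h : BoundsFlatHalfPlane L) : BoundsFlatHalfPlane L' := by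
  obtain ⟨c, hc, rfl, a, ha, hgc⟩ := hL
  obtain ⟨c', hc', rfl, a', ha', hgc'⟩ := hL'
  obtain rfl : a = a' := by rw [← translationLength_eq hc ha hgc, translationLength_eq hc' ha' hgc']
  obtain ⟨ψ, hψ0, hψ⟩ := h.exists_coordinates hc (Set.mem_univ 0) (Set.mem_univ 1) one_pos
    (Set.image_univ.subset)
  replace hψ0 (s : ℝ) : ψ s 0 = c s := hψ0 s (Set.mem_univ s)
  -- Both axes have translation length `a`, so parameters reduce to `[0, a)` and the axes stay
  -- within `K`.
  set K := dist (c 0) (c' 0) + 2 * a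
  have hK (s : ℝ) : dist (c s) (c' s) ≤ K := by
    have e : s = s - ⌊s / a⌋ * a + ⌊s / a⌋ * a := by ring
    have l1 := Int.floor_le (s / a)
    have l2 := Int.lt_floor_add_one (s / a)
    rw [le_div_iff₀ ha] at l1
    rw [div_lt_iff₀ ha] at l2
    rw [e, ← IsometryEquiv.zpow_apply_geodesic hgc, ← IsometryEquiv.zpow_apply_geodesic hgc',
      IsometryEquiv.dist_eq]
    have := dist_triangle4 (c (s - ⌊s / a⌋ * a)) (c 0) (c' 0) (c' (s - ⌊s / a⌋ * a))
    rw [hc.dist_eq, hc'.dist_eq, Real.dist_eq, Real.dist_eq, sub_zero, zero_sub, abs_neg,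
      abs_of_nonneg (by linarith)] at this
    linarith
  have hstrip (n : ℕ) (hn : K < n) : ∃ φ : ℝ → ℝ → X, (∀ s, φ s 0 = c' s) ∧ ∀ s r,
      ∀ u ∈ Set.Icc 0 (n - K), ∀ v ∈ Set.Icc 0 (n - K),
        dist (φ s u) (φ r v) ^ 2 = (s - r) ^ 2 + (u - v) ^ 2 := by
    have hn0 : (0 : ℝ) ≤ n := n.cast_nonneg
    have hℓ : Isometry fun s => ψ s n := by
      refine Isometry.of_dist_eq fun s r => (sq_eq_sq₀ dist_nonneg dist_nonneg).1 ?_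
      rw [hψ _ _ _ _ hn0 hn0, Real.dist_eq, sq_abs]
      ring
    have hcℓ (s r : ℝ) : dist (c s) (ψ r n) ^ 2 = (s - r) ^ 2 + n ^ 2 := by
      rw [← hψ0, hψ _ _ _ _ le_rfl hn0]
      ring
    obtain ⟨β, w, hw0, hw⟩ := exists_dist_sq_parallel hc' hℓ (K := K + n) fun s => by
      have h1 : dist (c s) (ψ s n) = n := (sq_eq_sq₀ dist_nonneg hn0).1 (by rw [hcℓ]; ring)
      have h2 := dist_triangle (c' s) (c s) (ψ s n)
      rw [dist_comm (c' s) (c s)] at h2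
      linarith [hK s]
    -- The line at height `n` is at distance `n` from `c`, hence at least `n - K` from `c'`.
    have hwn : n - K ≤ w := by
      have h1 : dist (c' 0) (ψ (-β) n) = w :=
        (sq_eq_sq₀ dist_nonneg hw0).1 (by rw [hw]; ring)
      have h2 : (n : ℝ) ≤ dist (c 0) (ψ (-β) n) :=
        le_of_sq_le_sq (by rw [hcℓ]; nlinarith [sq_nonneg (0 - -β)]) dist_nonneg
      linarith [dist_triangle (c 0) (c' 0) (ψ (-β) n), hK 0]
    obtain ⟨φ, hφ0, hφ⟩ := exists_flatStrip (c' := fun s => ψ (s - β) n) (w := w) (by linarith) hc'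
      (hℓ.comp (by simpa [sub_eq_add_neg] using isometry_add_right (-β))) fun s r => by
        rw [hw]; ring
    exact ⟨φ, hφ0, fun s r u hu v hv => hφ s r u ⟨hu.1, hu.2.trans hwn⟩ v ⟨hv.1, hv.2.trans hwn⟩⟩
  have hex (n : ℕ) : ∃ φ : ℝ → ℝ → X, K < n → (∀ s, φ s 0 = c' s) ∧ ∀ s r,
      ∀ u ∈ Set.Icc 0 (n - K), ∀ v ∈ Set.Icc 0 (n - K),
        dist (φ s u) (φ r v) ^ 2 = (s - r) ^ 2 + (u - v) ^ 2 := by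
    by_cases hn : K < n
    · obtain ⟨φ, hφ⟩ := hstrip n hn
      exact ⟨φ, fun _ => hφ⟩
    · exact ⟨ψ, fun h => (hn h).elim⟩
  choose φ hφ using hex
  have hlarge (R : ℝ) : ∀ᶠ n : ℕ in atTop, R < n :=
    tendsto_natCast_atTop_atTop.eventually_gt_atTop R
  refine boundsFlatHalfPlane_of_eventually φ (fun s r u v hu hv => ?_) fun s => ?_
  · filter_upwards [hlarge K, hlarge (u + K), hlarge (v + K)] with n h1 h2 h3
    exact (hφ n h1).2 s r u ⟨hu, by linarith⟩ v ⟨hv, by linarith⟩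
  · filter_upwards [hlarge K] with n hn
    exact (hφ n hn).1 s

/-- `ρ` may run against the direction of translation, so `b` is only nonzero. -/
theorem IsTranslationAxis.exists_translation {g : X ≃ᵢ X} {ρ : ℝ → X} (hρ : Isometry ρ)
    (h : IsTranslationAxis g (Set.range ρ)) : ∃ b ≠ 0, ∀ s, g (ρ s) = ρ (s + b) := by
  obtain ⟨c, hc, hcρ, a, ha, hgc⟩ := h
  obtain ⟨ε, τ, hε, hρc⟩ := exists_reparametrization hc hρ (Set.mem_univ 0) (Set.mem_univ 1)
    one_pos (by rw [Set.image_univ, hcρ])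
  refine ⟨ε * a, by rcases hε with rfl | rfl <;> simp [ha.ne'], fun s => ?_⟩
  have hε2 : ε * ε = 1 := by rcases hε with rfl | rfl <;> norm_num
  rw [hρc s (Set.mem_univ _), hρc _ (Set.mem_univ _), hgc]
  congr 1
  linear_combination (-a) * hε2

end HalfPlane

theorem mainTheorem4 {X : Type*} [MetricSpace X] [ProperSpace X] [IsCAT0Space X]
    (G : Subgroup (X ≃ᵢ X)) (ρ : ℝ → X) (hρ : Isometry ρ)
    (t : ℕ → ℝ) (ht_pos : ∀ n, 0 < t n) (ht_mono : StrictMono t)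
    (ht_top : Filter.Tendsto t Filter.atTop Filter.atTop)
    (ht_bdd : BddAbove (Set.range fun n => dist (ρ (t n)) (ρ (t (n + 1)))))
    (h_orbits : (Set.range fun n => isometryOrbit G (ρ (t n))).Finite)
    (h_discrete : ∀ n, DiscreteTopology (isometryOrbit G (ρ (t n)))) :
    (∃ f : ℕ → ℕ, StrictMono f ∧ (∀ n, 0 < f n) ∧
      ∀ m n : ℕ, 0 < m → m < n → ∃ h ∈ G, IsClosingIsometry ρ (t (f m)) (t (f n)) h) ∧
    ((∃ g : X ≃ᵢ X, IsRankOneIsometry g ∧ IsTranslationAxis g (Set.range ρ)) →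
      ∀ f : ℕ → ℕ, StrictMono f → (∀ n, 0 < f n) →
        ∀ m : ℕ, 0 < m → ∃ N : ℕ, 0 < N ∧ ∀ n : ℕ, N < n → m < n →
          ∀ h ∈ G, IsClosingIsometry ρ (t (f m)) (t (f n)) h → IsRankOneIsometry h) := by
  refine ⟨?_, ?_⟩
  · obtain ⟨f, hf, hf0, hfh⟩ := exists_closing_subsequence G ρ hρ t ht_mono ht_bdd h_orbits
      h_discrete
    exact ⟨f, hf, hf0, fun m n _ hmn => hfh m n hmn⟩
  · rintro ⟨g, ⟨-, L, hgL, -, hL⟩, hgρ⟩ f hf - m -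
    obtain ⟨b, hb, hgb⟩ := hgρ.exists_translation hρ
    by_contra! hcon
    -- `L` is the rank-one axis of `g`, possibly different from `ρ(ℝ)`.
    refine hL (.of_isTranslationAxis hgρ hgL (boundsFlatHalfPlane_of_segments hρ hb hgb fun R => ?_))
    obtain ⟨N, hN⟩ := eventually_atTop.1
      ((ht_top.comp hf.tendsto_atTop).eventually_ge_atTop (R + t (f m)))
    obtain ⟨n, hn, -, h, -, ⟨hh, A, hA, hsub⟩, hnot⟩ := hcon (N + 1) N.succ_pos
    refine ⟨t (f m), t (f n), A, ?_, hsub, ?_⟩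
    · have := hN n (by omega)
      simp only [Function.comp_apply] at this
      linarith
    -- If `A` bounded no flat half-plane, it would itself make `h` rank-one.
    · by_contra hA'
      obtain ⟨c, hc, hcA, -⟩ := id hA
      exact hnot ⟨hh, A, hA, ⟨c, hc, hcA⟩, hA'⟩
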